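/- **Theorem (bicrossed product of a matched pair of $L_\infty$-algebras).** Everything is over a field $\mathbf k$ of characteristic zero. *Conventions.* $\varepsilon(\sigma)$ is the Koszul sign of a permutation $\sigma$ of homogeneous letters, $(-1)^\sigma$ its signature, and $\mathrm{Sh}(p,q)\subset\mathbb S_{p+q}$ the set of $(p,q)$-shuffles. An *$L_\infty$-algebra* is a graded space $\mathcal G=\bigoplus_{i\in\mathbb Z}\mathcal G^i$ with graded skew-symmetric linear maps $\mu_k:\mathcal G^{\otimes k}\to\mathcal G$ of degree $k-2$ $(k\ge1)$ such that for all $N\ge 1$ and homogeneous $x_1,\dots,x_N$ $$\sum_{k+l=N+1}\ \sum_{\sigma\in \mathrm{Sh}(l,k-1)}(-1)^\sigma\varepsilon(\sigma)(-1)^{l(k-1)}\mu_k\big(\mu_l(x_{\sigma(1)},\dots,x_{\sigma(l)}),x_{\sigma(l+1)},\dots,x_{\sigma(N)}\big)=0 .$$ A *representation* of it on a graded space $\mathcal H$ is a family of linear maps $\rho_k:\mathcal G^{\otimes k-1}\otimes\mathcal H\to\mathcal H$ of degree $k-2$ $(k\ge 1)$, graded skew-symmetric in the inputs from $\mathcal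 G$, such that for all $N\ge1$ and homogeneous $x_1,\dots,x_{N-1}\in\mathcal G$, $x_N\in\mathcal H$ $$\sum_{k+l=N+1}\ \sum_{\substack{\sigma\in \mathrm{Sh}(l,k-1)\\ \sigma(l)=N}}(-1)^\sigma\varepsilon(\sigma)(-1)^{(l-1)(k-1)+(|x_{\sigma(1)}|+\cdots+|x_{\sigma(l)}|+l)(|x_{\sigma(l+1)}|+\cdots+|x_{\sigma(N)}|)}\rho_k\big(x_{\sigma(l+1)},\dots,x_{\sigma(N)},\rho_l(x_{\sigma(1)},\dots,x_{\sigma(l)})\big)$$ $$+\sum_{\substack{k+l=N+1\\ k\ge2}}\ \sum_{\substack{\sigma\in \mathrm{Sh}(l,k-1)\\ \sigma(N)=N}}(-1)^\sigma\varepsilon(\sigma)(-1)^{l(k-1)}\rho_k\big(\mu_l(x_{\sigma(1)},\dots,x_{\sigma(l)}),x_{\sigma(l+1)},\dots,x_{\sigma(N)}\big)=0 .$$ A *matched pair of $L_\infty$-algebras* consists of $L_\infty$-algebras $(\mathcal G,\{\mu_k\})$ and $(\mathcal H,\{\nu_k\})$, a representation $\{\rho_k\}$ of $\mathcal G$ on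 $\mathcal H$ and a representation $\{\psi_k\}$ of $\mathcal H$ on $\mathcal G$ such that the following compatibility condition, and the one obtained from it by interchanging $(\mathcal G,\mu,\rho,x)$ and $(\mathcal H,\nu,\psi,h)$, hold for all $N\ge1$ and all homogeneous $(x_1,h_1),\dots,(x_N,h_N)\in\mathcal G\oplus\mathcal H$, of degrees $d_1,\dots,d_N$: $$\sum_{k+l=N+1}\ \sum_{\sigma\in\mathrm{Sh}(l,k-1)}(-1)^\sigma\varepsilon(\sigma)(-1)^{l(k-1)}\,T_{k,l,\sigma}=0,$$ where, writing $y_i=x_{\sigma(i)}$, $g_i=h_{\sigma(i)}$, $e_i=d_{\sigma(i)}$ for $1\le i\le N$, $$\alpha_i=(-1)^{l-i+e_i(e_{i+1}+\cdots+e_l)}\ (1\le i\le l),\qquad \beta_j=(-1)^{k-1-j+e_{l+j}(e_{l+j+1}+\cdots+e_N)}\ (1\le j\le k-1),$$ $$\gamma=(-1)^{k-1+(e_1+\cdots+e_l+l-2)(e_{l+1}+\cdots+e_N)},$$ $T_{k,l,\sigma}$ is the sum $$\begin{aligned}T_{k,l,\sigma}={}&\mu_k\big(\mu_l(y_1,\dots,y_l),y_{l+1},\dots,y_N\big)+\sum_{i=1}^l\alpha_i\,\mu_k\big(\psi_l(g_1,\dots,\widehat{g_i},\dots,g_l,y_i),y_{l+1},\dots,y_N\big)\\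 &+\sum_{j=1}^{k-1}\beta_j\,\psi_k\big(\nu_l(g_1,\dots,g_l),g_{l+1},\dots,\widehat{g_{l+j}},\dots,g_N,y_{l+j}\big)\\ &+\sum_{j=1}^{k-1}\sum_{i=1}^{l}\alpha_i\beta_j\,\psi_k\big(\rho_l(y_1,\dots,\widehat{y_i},\dots,y_l,g_i),g_{l+1},\dots,\widehat{g_{l+j}},\dots,g_N,y_{l+j}\big)\\ &+\gamma\,\psi_k\big(g_{l+1},\dots,g_N,\mu_l(y_1,\dots,y_l)\big)+\sum_{i=1}^l\alpha_i\gamma\,\psi_k\big(g_{l+1},\dots,g_N,\psi_l(g_1,\dots,\widehat{g_i},\dots,g_l,y_i)\big).\end{aligned}$$ *Statement.* (1) Let $\big((\mathcal G,\{\mu_k\}),(\mathcal H,\{\nu_k\}),\{\rho_k\},\{\psi_k\}\big)$ be a matched pair of $L_\infty$-algebras. Then there is a unique family of linear maps $l_k:(\mathcal G\oplus\mathcal H)^{\otimes k}\to\mathcal G\oplus\mathcal H$ $(k\ge1)$ that is given on homogeneous elements by $l_k=\mu_k\ltimes\rho_k+\psi_k\rtimes\nu_k$, that is, $$\begin{aligned}l_k\big((x_1,h_1),\dots,(x_k,h_k)\big)=\Big(&\mu_k(x_1,\dots,x_k)+\sum_{i=1}^k(-1)^{k-i}(-1)^{|x_i|(|h_{i+1}|+\cdots+|h_k|)}\psi_k(h_1,\dots,\widehat{h_i},\dots,h_k,x_i),\\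 &\nu_k(h_1,\dots,h_k)+\sum_{i=1}^k(-1)^{k-i}(-1)^{|h_i|(|x_{i+1}|+\cdots+|x_k|)}\rho_k(x_1,\dots,\widehat{x_i},\dots,x_k,h_i)\Big),\end{aligned}$$ and $(\mathcal G\oplus\mathcal H,\{l_k\}_{k\ge1})$ is an $L_\infty$-algebra. (2) This generalizes the bicrossed product of Lie algebras: let $\mathfrak g,\mathfrak h$ be Lie algebras with representations $\rho$ of $\mathfrak g$ on $\mathfrak h$ and $\psi$ of $\mathfrak h$ on $\mathfrak g$ forming a matched pair of Lie algebras, i.e. $\rho_x[h,k]=[\rho_xh,k]+[h,\rho_xk]+\rho_{\psi_kx}h-\rho_{\psi_hx}k$ and $\psi_h[x,y]=[\psi_hx,y]+[x,\psi_hy]+\psi_{\rho_yh}x-\psi_{\rho_xh}y$. Placed in degree $0$, with $\mu_2,\nu_2$ the brackets, $\rho_2=\rho$, $\psi_2=\psi$ and all other maps zero, they form a matched pair of $L_\infty$-algebras, for which $l_k=0$ for $k\ne2$ and $$l_2\big((x,h),(y,k)\big)=\big([x,y]+\psi_hy-\psi_kx,\ [h,k]+\rho_xk-\rho_yh\big).$$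 -/

import Mathlib

open Finset

namespace LInf

section Signs

/-- The Koszul sign `ε(σ)` of a permutation `σ` of homogeneous letters of degrees `d`:
`x₁ ⊙ ⋯ ⊙ x_N = ε(σ) x_{σ(1)} ⊙ ⋯ ⊙ x_{σ(N)}` in the graded symmetric algebra. -/
def koszul {N : ℕ} (d : Fin N → ℤ) (σ : Equiv.Perm (Fin N)) : ℤˣ :=
  ∏ p : Fin N, ∏ q : Fin N with p < q ∧ σ q < σ p, (d (σ p) * d (σ q)).negOnePow

/-- The `(p, q)`-shuffles: permutations of `p + q` letters that are increasing on the first `p`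
and on the last `q` positions. -/
def shuffles (p q : ℕ) : Finset (Equiv.Perm (Fin (p + q))) :=
  {σ | (∀ i j : Fin p, i < j → σ (Fin.castAdd q i) < σ (Fin.castAdd q j)) ∧
    ∀ i j : Fin q, i < j → σ (Fin.natAdd p i) < σ (Fin.natAdd p j)}

/-- The sign `(-1)^{k-i} (-1)^{|x_i| (|x_{i+1}| + ⋯ + |x_k|)}` (in 1-based numbering) of moving the
`i`-th of `k = n + 1` letters of degrees `d` to the last place. -/
def moveSign {n : ℕ} (d : Fin (n + 1) → ℤ) (i : Fin (n + 1)) : ℤˣ :=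
  ((n : ℤ) - (i : ℕ) + d i * ∑ j with i < j, d j).negOnePow

/-- A pair `p = (a, b)` with `a + b = n` stands for arities `k = a + 1`, `l = b + 1` with
`k + l = N + 1`, `N = n + 1`. -/
theorem arity {n : ℕ} (p : {p : ℕ × ℕ // p ∈ antidiagonal n}) :
    p.1.2 + 1 + p.1.1 = n + 1 := by
  have h := mem_antidiagonal.1 p.2
  omega

end Signs

section Defs

variable {K : Type*} [Field K]
  {V : Type*} [AddCommGroup V] [Module K V] {W : Type*} [AddCommGroup W] [Module K W]

/-- Families `(μ_k)_{k ≥ 1}` of linear maps `V^{⊗k} → V`; the entry at `n` is `μ_{n+1}`. -/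
abbrev Brackets (K V : Type*) [Field K] [AddCommGroup V] [Module K V] :=
  (n : ℕ) → MultilinearMap K (fun _ : Fin (n + 1) => V) V

/-- Families `(ρ_k)_{k ≥ 1}` of linear maps `V^{⊗(k-1)} ⊗ W → W`; the entry at `n` is `ρ_{n+1}`. -/
abbrev Actions (K V W : Type*) [Field K] [AddCommGroup V] [Module K V]
    [AddCommGroup W] [Module K W] :=
  (n : ℕ) → MultilinearMap K (fun _ : Fin n => V) (W →ₗ[K] W)

/-- Graded skew-symmetry of a multilinear map on the graded space `(V, 𝒢)`. -/
def IsGradedSkew {U : Type*} [AddCommGroup U] [Module K U] (𝒢 : ℤ → Submodule K V) {n : ℕ}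
    (f : MultilinearMap K (fun _ : Fin n => V) U) : Prop :=
  ∀ (d : Fin n → ℤ) (x : Fin n → V), (∀ i, x i ∈ 𝒢 (d i)) → ∀ σ : Equiv.Perm (Fin n),
    f x = (σ.sign * koszul d σ) • f (fun i => x (σ i))

/-- The `(k, l)`-part, `k = a + 1`, `l = b + 1`, of the higher Jacobi identity:
the sum over `σ ∈ Sh(l, k-1)` of
`(-1)^σ ε(σ) (-1)^{l(k-1)} μ_k (μ_l (x_{σ(1)}, …, x_{σ(l)}), x_{σ(l+1)}, …, x_{σ(N)})`. -/
def jacobiTerm (μ : Brackets K V) (a b : ℕ) (d : Fin (b + 1 + a) → ℤ)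
    (x : Fin (b + 1 + a) → V) : V :=
  ∑ σ ∈ shuffles (b + 1) a,
    (σ.sign * koszul d σ * (((b + 1) * a : ℕ) : ℤ).negOnePow) •
      μ a (Fin.cons (μ b fun i => x (σ (Fin.castAdd a i))) fun j => x (σ (Fin.natAdd (b + 1) j)))

/-- `(V, {μ_k})`, with `V = ⨁ 𝒢 i`, is an `L_∞`-algebra (with `deg μ_k = k - 2`). -/
structure IsLInfinityAlgebra (𝒢 : ℤ → Submodule K V) (μ : Brackets K V) : Prop where
  isInternal : DirectSum.IsInternal 𝒢
  degree : ∀ (n : ℕ) (d : Fin (n + 1) → ℤ) (x : Fin (n + 1) → V), (∀ i, x i ∈ 𝒢 (d i)) →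
    μ n x ∈ 𝒢 ((∑ i, d i) + ((n : ℤ) + 1 - 2))
  skew : ∀ n : ℕ, IsGradedSkew 𝒢 (μ n)
  jacobi : ∀ (n : ℕ) (d : Fin (n + 1) → ℤ) (x : Fin (n + 1) → V), (∀ i, x i ∈ 𝒢 (d i)) →
    ∑ p ∈ (antidiagonal n).attach,
      jacobiTerm μ p.1.1 p.1.2 (fun i => d (Fin.cast (arity p) i))
        (fun i => x (Fin.cast (arity p) i)) = 0

/-- The `(k, l)`-part, `k = a + 1`, `l = b + 1`, of the first sum in the representation identity:
the sum over `σ ∈ Sh(l, k-1)` with `σ(l) = N` of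
`± ρ_k (x_{σ(l+1)}, …, x_{σ(N)}, ρ_l (x_{σ(1)}, …, x_{σ(l-1)}, h))`, where `h` is the `N`-th
letter. (The entry of `x` at the last place does not occur.) -/
def repTermInner (ρ : Actions K V W) (a b : ℕ) (d : Fin (b + 1 + a) → ℤ)
    (x : Fin (b + 1 + a) → V) (h : W) : W :=
  ∑ σ ∈ shuffles (b + 1) a with (σ (Fin.castAdd a (Fin.last b)) : ℕ) = b + a,
    (σ.sign * koszul d σ * (((b + 1) * a : ℕ) : ℤ).negOnePow *
      ((a : ℤ) + ((∑ i, d (σ (Fin.castAdd a i))) + ((b : ℤ) + 1 - 2)) *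
        ∑ j, d (σ (Fin.natAdd (b + 1) j))).negOnePow) •
      ρ a (fun j => x (σ (Fin.natAdd (b + 1) j)))
        (ρ b (fun i => x (σ (Fin.castAdd a i.castSucc))) h)

/-- The `(k, l)`-part, `k = a + 1`, `l = b + 1`, of the second sum in the representation identity:
the sum over `σ ∈ Sh(l, k-1)` with `σ(N) = N` (and `N > l`) of
`± ρ_k (μ_l (x_{σ(1)}, …, x_{σ(l)}), x_{σ(l+1)}, …, x_{σ(N-1)}, h)`. -/
def repTermOuter (μ : Brackets K V) (ρ : Actions K V W) : (a b : ℕ) →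
    (Fin (b + 1 + a) → ℤ) → (Fin (b + 1 + a) → V) → W → W
  | 0, _, _, _, _ => 0
  | a + 1, b, d, x, h =>
    ∑ σ ∈ shuffles (b + 1) (a + 1) with σ (Fin.last (b + 1 + a)) = Fin.last (b + 1 + a),
      (σ.sign * koszul d σ * (((b + 1) * (a + 1) : ℕ) : ℤ).negOnePow) •
        ρ (a + 1) (Fin.cons (μ b fun i => x (σ (Fin.castAdd (a + 1) i)))
          fun j : Fin a => x (σ (Fin.natAdd (b + 1) j.castSucc))) h

/-- `{ρ_k}` is a representation of `(V, 𝒢, {μ_k})` on the graded space `W = ⨁ ℋ i`. In the identity,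
the `N`-th letter is `h`, of degree `d N`; the entry `x N` does not occur. -/
structure IsRepresentation (𝒢 : ℤ → Submodule K V) (μ : Brackets K V)
    (ℋ : ℤ → Submodule K W) (ρ : Actions K V W) : Prop where
  isInternal : DirectSum.IsInternal ℋ
  degree : ∀ (n : ℕ) (d : Fin n → ℤ) (e : ℤ) (x : Fin n → V) (h : W),
    (∀ i, x i ∈ 𝒢 (d i)) → h ∈ ℋ e → ρ n x h ∈ ℋ ((∑ i, d i) + e + ((n : ℤ) + 1 - 2))
  skew : ∀ n : ℕ, IsGradedSkew 𝒢 (ρ n)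
  identity : ∀ (n : ℕ) (d : Fin (n + 1) → ℤ) (x : Fin (n + 1) → V) (h : W),
    (∀ i, x i ∈ 𝒢 (d i)) → h ∈ ℋ (d (Fin.last n)) →
    ∑ p ∈ (antidiagonal n).attach,
        repTermInner ρ p.1.1 p.1.2 (fun i => d (Fin.cast (arity p) i))
          (fun i => x (Fin.cast (arity p) i)) h +
      ∑ p ∈ (antidiagonal n).attach,
        repTermOuter μ ρ p.1.1 p.1.2 (fun i => d (Fin.cast (arity p) i))
          (fun i => x (Fin.cast (arity p) i)) h = 0

/-- The summand for a fixed shuffle of the (first) compatibility condition, without the common sign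
`(-1)^σ ε(σ) (-1)^{l(k-1)}`. Here `k = a + 1`, `l = b + 1`; the letters in the first `l` places
are `(x i, h i)` of degree `d i`, those in the last `k - 1` places are `(x' j, h' j)` of degree
`d' j`. The six summands are, up to sign,
`μ_k (μ_l (x, …), x', …)`,
`μ_k (ψ_l (h, …, x i), x', …)`,
`ψ_k (ν_l (h, …), h', …, x' j)`,
`ψ_k (ρ_l (x, …, h i), h', …, x' j)`,
`ψ_k (h', …, μ_l (x, …))` and
`ψ_k (h', …, ψ_l (h, …, x i))`;
in the third and the fourth, the entry `h' j` is left out. -/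
def compatSummand (μ : Brackets K V) (ν : Brackets K W) (ρ : Actions K V W) (ψ : Actions K W V)
    {a b : ℕ} (d : Fin (b + 1) → ℤ) (d' : Fin a → ℤ) (x : Fin (b + 1) → V) (x' : Fin a → V)
    (h : Fin (b + 1) → W) (h' : Fin a → W) : V :=
  -- the sign of moving `x' j` behind the later ones of `h'`
  let s : Fin a → ℤˣ := fun j =>
    ((a : ℤ) - 1 - (j : ℕ) + d' j * ∑ j' with j < j', d' j').negOnePow
  -- the sign of moving the value of an operation with `l` inputs behind all of `h'`
  let t : ℤˣ := ((a : ℤ) + ((∑ i, d i) + ((b : ℤ) + 1 - 2)) * ∑ j, d' j).negOnePow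
  μ a (Fin.cons (μ b x) x') +
  ∑ i, moveSign d i • μ a (Fin.cons (ψ b (i.removeNth h) (x i)) x') +
  ∑ j, s j • ψ a (j.succ.removeNth (Fin.cons (ν b h) h' : Fin (a + 1) → W)) (x' j) +
  ∑ j, ∑ i, (moveSign d i * s j) •
    ψ a (j.succ.removeNth (Fin.cons (ρ b (i.removeNth x) (h i)) h' : Fin (a + 1) → W)) (x' j) +
  t • ψ a h' (μ b x) +
  ∑ i, (moveSign d i * t) • ψ a h' (ψ b (i.removeNth h) (x i))

/-- The `(k, l)`-part, `k = a + 1`, `l = b + 1`, of the compatibility condition. -/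
def compatTerm (μ : Brackets K V) (ν : Brackets K W) (ρ : Actions K V W) (ψ : Actions K W V)
    (a b : ℕ) (d : Fin (b + 1 + a) → ℤ) (x : Fin (b + 1 + a) → V) (h : Fin (b + 1 + a) → W) : V :=
  ∑ σ ∈ shuffles (b + 1) a,
    (σ.sign * koszul d σ * (((b + 1) * a : ℕ) : ℤ).negOnePow) •
      compatSummand μ ν ρ ψ
        (fun i => d (σ (Fin.castAdd a i))) (fun j => d (σ (Fin.natAdd (b + 1) j)))
        (fun i => x (σ (Fin.castAdd a i))) (fun j => x (σ (Fin.natAdd (b + 1) j)))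
        (fun i => h (σ (Fin.castAdd a i))) (fun j => h (σ (Fin.natAdd (b + 1) j)))

/-- A matched pair of `L_∞`-algebras. The second compatibility condition is the first one with the
two algebras and the two actions interchanged. -/
structure IsMatchedPair (𝒢 : ℤ → Submodule K V) (μ : Brackets K V)
    (ℋ : ℤ → Submodule K W) (ν : Brackets K W) (ρ : Actions K V W) (ψ : Actions K W V) :
    Prop where
  left : IsLInfinityAlgebra 𝒢 μ
  right : IsLInfinityAlgebra ℋ ν
  rep_left : IsRepresentation 𝒢 μ ℋ ρ
  rep_right : IsRepresentation ℋ ν 𝒢 ψ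
  compat_left : ∀ (n : ℕ) (d : Fin (n + 1) → ℤ) (x : Fin (n + 1) → V) (h : Fin (n + 1) → W),
    (∀ i, x i ∈ 𝒢 (d i)) → (∀ i, h i ∈ ℋ (d i)) →
    ∑ p ∈ (antidiagonal n).attach,
      compatTerm μ ν ρ ψ p.1.1 p.1.2 (fun i => d (Fin.cast (arity p) i))
        (fun i => x (Fin.cast (arity p) i)) (fun i => h (Fin.cast (arity p) i)) = 0
  compat_right : ∀ (n : ℕ) (d : Fin (n + 1) → ℤ) (x : Fin (n + 1) → V) (h : Fin (n + 1) → W),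
    (∀ i, x i ∈ 𝒢 (d i)) → (∀ i, h i ∈ ℋ (d i)) →
    ∑ p ∈ (antidiagonal n).attach,
      compatTerm ν μ ψ ρ p.1.1 p.1.2 (fun i => d (Fin.cast (arity p) i))
        (fun i => h (Fin.cast (arity p) i)) (fun i => x (Fin.cast (arity p) i)) = 0

/-- The grading of the direct sum: `(𝒢 ⊕ ℋ)^i = 𝒢^i ⊕ ℋ^i`. -/
def sumGrading (𝒢 : ℤ → Submodule K V) (ℋ : ℤ → Submodule K W) : ℤ → Submodule K (V × W) :=
  fun i => (𝒢 i).prod (ℋ i)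

/-- `μ_k ⋉ ρ_k`, evaluated at pairs `(x i, h i)` that are homogeneous of degree `d i`. -/
def ltimes (μ : Brackets K V) (ρ : Actions K V W) (n : ℕ) (d : Fin (n + 1) → ℤ)
    (x : Fin (n + 1) → V) (h : Fin (n + 1) → W) : V × W :=
  (μ n x, ∑ i, moveSign d i • ρ n (i.removeNth x) (h i))

/-- `ψ_k ⋊ ν_k`, evaluated at pairs `(x i, h i)` that are homogeneous of degree `d i`. -/
def rtimes (ψ : Actions K W V) (ν : Brackets K W) (n : ℕ) (d : Fin (n + 1) → ℤ)
    (x : Fin (n + 1) → V) (h : Fin (n + 1) → W) : V × W :=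
  (∑ i, moveSign d i • ψ n (i.removeNth h) (x i), ν n h)

/-- `l_k = μ_k ⋉ ρ_k + ψ_k ⋊ ν_k` for all `k ≥ 1`, on homogeneous elements (hence everywhere, by
multilinearity). -/
def IsBicrossed (𝒢 : ℤ → Submodule K V) (μ : Brackets K V) (ℋ : ℤ → Submodule K W)
    (ν : Brackets K W) (ρ : Actions K V W) (ψ : Actions K W V) (l : Brackets K (V × W)) : Prop :=
  ∀ (n : ℕ) (d : Fin (n + 1) → ℤ) (z : Fin (n + 1) → V × W),
    (∀ i, z i ∈ sumGrading 𝒢 ℋ (d i)) →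
    l n z = ltimes μ ρ n d (fun i => (z i).1) (fun i => (z i).2) +
      rtimes ψ ν n d (fun i => (z i).1) (fun i => (z i).2)

end Defs

section Lie

variable (K : Type*) [Field K]

/-- The grading that is concentrated in degree `0`. -/
def degreeZero (V : Type*) [AddCommGroup V] [Module K V] : ℤ → Submodule K V :=
  fun i => if i = 0 then ⊤ else ⊥

/-- A Lie bracket as a family with `μ_2 = [ , ]` and `μ_k = 0` for `k ≠ 2`. -/
def lieBrackets (g : Type*) [LieRing g] [LieAlgebra K g] : Brackets K g
  | 1 => LinearMap.uncurryLeft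
      ((MultilinearMap.ofSubsingletonₗ K K g g (0 : Fin 1)).toLinearMap ∘ₗ
        LinearMap.mk₂ K (fun x y : g => ⁅x, y⁆) add_lie smul_lie lie_add
          (fun c x y => lie_smul c x y))
  | _ => 0

variable {K}

/-- An action of a Lie algebra as a family with `ρ_2 (x, h) = ρ_x h` and `ρ_k = 0` for `k ≠ 2`. -/
def lieActions {g h : Type*} [LieRing g] [LieAlgebra K g] [LieRing h] [LieAlgebra K h]
    (ρ : g →ₗ[K] Module.End K h) : Actions K g h
  | 1 => MultilinearMap.ofSubsingleton K g (Module.End K h) (0 : Fin 1) ρ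
  | _ => 0

theorem lieBrackets_one (g : Type*) [LieRing g] [LieAlgebra K g] (x : Fin 2 → g) :
    lieBrackets K g 1 x = ⁅x 0, x 1⁆ := rfl

theorem lieActions_one {g h : Type*} [LieRing g] [LieAlgebra K g] [LieRing h] [LieAlgebra K h]
    (ρ : g →ₗ[K] Module.End K h) (x : Fin 1 → g) (u : h) : lieActions ρ 1 x u = ρ (x 0) u := rfl

/-- A matched pair of Lie algebras. -/
structure IsLieMatchedPair {g h : Type*} [LieRing g] [LieAlgebra K g] [LieRing h] [LieAlgebra K h]
    (ρ : g →ₗ[K] Module.End K h) (ψ : h →ₗ[K] Module.End K g) : Prop where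
  rep_left : ∀ (x y : g) (u : h), ρ ⁅x, y⁆ u = ρ x (ρ y u) - ρ y (ρ x u)
  rep_right : ∀ (u v : h) (x : g), ψ ⁅u, v⁆ x = ψ u (ψ v x) - ψ v (ψ u x)
  compat_left : ∀ (x : g) (u v : h),
    ρ x ⁅u, v⁆ = ⁅ρ x u, v⁆ + ⁅u, ρ x v⁆ + ρ (ψ v x) u - ρ (ψ u x) v
  compat_right : ∀ (u : h) (x y : g),
    ψ u ⁅x, y⁆ = ⁅ψ u x, y⁆ + ⁅x, ψ u y⁆ + ψ (ρ y u) x - ψ (ρ x u) y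

end Lie

end LInf

/-!
On letters of fixed degrees, the bicrossed formula is a sum of multilinear maps. Such degreewise
formulas glue to a unique family `l`, because the sum grading is a direct sum decomposition.

In a sign `(-1)^σ ε(σ)`, or in the sign of moving a letter to the last place, each pair of letters
that is reversed contributes the factor `-(-1)^{|x||y|}`. Comparing the pairs reversed on both sides
yields the skew-symmetry of `l`.

When `l_k (l_l (z_1, …), …)` is expanded, its first component is the summand of the compatibility
condition and its second component is the summand of the interchanged one, so the higher Jacobi
identities of `l` are the two compatibility conditions.

In degree `0` only `k = l = 2` contributes, the three shuffles have signs `1, -1, 1`, and what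
remains are the Jacobi identity, the representation identities and the `g`- and `h`-components of
the Jacobi identity of the bicrossed Lie bracket.
-/

namespace LInf

section Gluing

variable {R : Type*} [CommSemiring R] {M N U : Type*} [AddCommMonoid M] [Module R M]
  [AddCommMonoid N] [Module R N] [AddCommMonoid U] [Module R U]

theorem existsUnique_multilinearMap_eqOn_homogeneous {ι : Type*} [Finite ι] {κ : ι → Type*}
    [∀ i, DecidableEq (κ i)] {E : ι → Type*} [∀ i, AddCommMonoid (E i)] [∀ i, Module R (E i)]
    {𝒢 : ∀ i, κ i → Submodule R (E i)} (h𝒢 : ∀ i, DirectSum.IsInternal (𝒢 i))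
    (F : (∀ i, κ i) → MultilinearMap R E U) :
    ∃! f : MultilinearMap R E U,
      ∀ (d : ∀ i, κ i) (x : ∀ i, E i), (∀ i, x i ∈ 𝒢 i (d i)) → f x = F d x := by
  classical
  let e i := LinearEquiv.ofBijective (DirectSum.coeLinearMap (𝒢 i)) (h𝒢 i)
  have e_symm {i j} (y : 𝒢 i j) : (e i).symm y = DirectSum.lof R (κ i) (fun j => 𝒢 i j) j y :=
    (e i).symm_apply_eq.2 (DirectSum.coeLinearMap_lof (𝒢 i) j y).symm
  let G : MultilinearMap R (fun i => DirectSum (κ i) fun j => 𝒢 i j) U :=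
    MultilinearMap.fromDirectSumEquiv
      fun d => (F d).compLinearMap fun i => (𝒢 i (d i)).subtype
  have G_symm (d : ∀ i, κ i) (x : ∀ i, 𝒢 i (d i)) :
      G (fun i => (e i).symm (x i)) = F d fun i => (x i : E i) := by
    simp only [e_symm]
    exact MultilinearMap.fromDirectSumEquiv_lof (M := fun i j => 𝒢 i j) _ d x
  refine ⟨G.compLinearMap fun i => (e i).symm.toLinearMap, fun d x hx => ?_, fun f hf => ?_⟩
  · lift x to ∀ i, 𝒢 i (d i) using hx
    exact G_symm d x
  · have hG : f.compLinearMap (fun i => (e i).toLinearMap) = G := by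
      refine MultilinearMap.directSum_ext fun d => MultilinearMap.ext fun x => ?_
      have he : ∀ i, e i (DirectSum.lof R (κ i) (fun j => 𝒢 i j) (d i) (x i)) = x i := fun i =>
        DirectSum.coeLinearMap_lof (𝒢 i) (d i) (x i)
      simp only [MultilinearMap.compLinearMap_apply, LinearEquiv.coe_coe, he]
      rw [hf d _ fun i => (x i).2, ← G_symm]
      simp only [e_symm]
    ext x
    simp [← hG]

/-- The multilinear map `z ↦ φ (w_0, …, w_{i-1}, w_{i+1}, …, w_n) v_i`, where `z_j = (v_j, w_j)`:
the `i`-th letter is acted upon by all the others. -/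
def insertAction {n : ℕ} (i : Fin (n + 1))
    (φ : MultilinearMap R (fun _ : Fin n => N) (M →ₗ[R] U)) :
    MultilinearMap R (fun _ : Fin (n + 1) => M × N) U :=
  LinearMap.uncurryMid i
    { toFun z := (LinearMap.applyₗ z.1).compMultilinearMap
        (φ.compLinearMap fun _ => LinearMap.snd R M N)
      map_add' _ _ := by ext; simp
      map_smul' _ _ := by ext; simp }

theorem insertAction_apply {n : ℕ} (i : Fin (n + 1))
    (φ : MultilinearMap R (fun _ : Fin n => N) (M →ₗ[R] U)) (z : Fin (n + 1) → M × N) :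
    insertAction i φ z = φ (i.removeNth fun j => (z j).2) (z i).1 := rfl

end Gluing

theorem isInternal_prod {R ι : Type*} [Ring R] [DecidableEq ι] {M N : Type*} [AddCommGroup M]
    [Module R M] [AddCommGroup N] [Module R N] {𝒢 : ι → Submodule R M} {ℋ : ι → Submodule R N}
    (h𝒢 : DirectSum.IsInternal 𝒢) (hℋ : DirectSum.IsInternal ℋ) :
    DirectSum.IsInternal fun i => (𝒢 i).prod (ℋ i) := by
  rw [DirectSum.isInternal_submodule_iff_iSupIndep_and_iSup_eq_top] at *
  constructor
  · intro i
    have h_le : ⨆ j, ⨆ _ : j ≠ i, (𝒢 j).prod (ℋ j) ≤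
        (⨆ j, ⨆ _ : j ≠ i, 𝒢 j).prod (⨆ j, ⨆ _ : j ≠ i, ℋ j) :=
      iSup₂_le fun j hj => Submodule.prod_mono (le_iSup₂_of_le j hj le_rfl)
        (le_iSup₂_of_le j hj le_rfl)
    refine Disjoint.mono_right h_le ?_
    rw [disjoint_iff, Submodule.prod_inf_prod, (h𝒢.1 i).eq_bot, (hℋ.1 i).eq_bot,
      Submodule.prod_bot]
  · rw [eq_top_iff, ← Submodule.prod_top, LinearMap.prod_eq_sup_map, ← h𝒢.2, ← hℋ.2,
      Submodule.map_iSup, Submodule.map_iSup]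
    refine sup_le (iSup_mono fun i => ?_) (iSup_mono fun i => ?_)
    · rw [Submodule.map_inl]
      exact Submodule.prod_mono le_rfl bot_le
    · rw [Submodule.map_inr]
      exact Submodule.prod_mono bot_le le_rfl

section Signs

theorem negOnePow_sum {ι : Type*} (s : Finset ι) (f : ι → ℤ) :
    (∑ i ∈ s, f i).negOnePow = ∏ i ∈ s, (f i).negOnePow := by
  classical
  induction s using Finset.induction_on with
  | empty => simp
  | insert a s ha ih => rw [sum_insert ha, prod_insert ha, Int.negOnePow_add, ih]

/-- The sign of interchanging two neighbouring letters of degrees `a` and `b` in the graded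
exterior algebra. -/
def swapSign (a b : ℤ) : ℤˣ := -(a * b).negOnePow

theorem swapSign_comm (a b : ℤ) : swapSign a b = swapSign b a := by
  rw [swapSign, swapSign, mul_comm]

theorem sign_mul_koszul {n : ℕ} (d : Fin n → ℤ) (σ : Equiv.Perm (Fin n)) :
    σ.sign * koszul d σ =
      ∏ p, ∏ q, if p < q ∧ σ q < σ p then swapSign (d (σ p)) (d (σ q)) else 1 := by
  rw [Equiv.Perm.sign_eq_prod_prod_Ioi, koszul, ← prod_mul_distrib]
  refine prod_congr rfl fun p _ => ?_
  rw [← filter_lt_eq_Ioi, prod_filter, prod_filter, ← prod_mul_distrib]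
  refine prod_congr rfl fun q _ => ?_
  by_cases hpq : p < q
  · rcases (σ.injective.ne hpq.ne').lt_or_gt with hσ | hσ
    · simp [hpq, hσ, hσ.not_gt, swapSign]
    · simp [hpq, hσ, hσ.not_gt]
  · simp [hpq]

theorem moveSign_eq_prod_Ioi {n : ℕ} (d : Fin (n + 1) → ℤ) (i : Fin (n + 1)) :
    moveSign d i = ∏ j ∈ Ioi i, swapSign (d i) (d j) := by
  have h_card : #(Ioi i) = n - i := by
    rw [Fin.card_Ioi]
    omega
  simp only [swapSign]
  rw [moveSign, filter_lt_eq_Ioi, mul_sum, Int.negOnePow_add, negOnePow_sum, prod_neg, h_card,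
    ← Nat.cast_sub (by omega), Int.negOnePow_def, zpow_natCast]

theorem moveSign_eq_prod_succAbove {n : ℕ} (d : Fin (n + 1) → ℤ) (i : Fin (n + 1)) :
    moveSign d i =
      ∏ j : Fin n, if i < i.succAbove j then swapSign (d i) (d (i.succAbove j)) else 1 := by
  rw [moveSign_eq_prod_Ioi, ← filter_lt_eq_Ioi, prod_filter, Fin.prod_univ_succAbove _ i,
    if_neg (lt_irrefl i), one_mul]

/-- The permutation that `σ` induces from the complement of `i` to the complement of `σ i`, both
numbered in increasing order. -/
def inducedPerm {n : ℕ} (σ : Equiv.Perm (Fin (n + 1))) (i : Fin (n + 1)) : Equiv.Perm (Fin n) :=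
  (finSuccAboveEquiv i).trans <|
    (σ.subtypeEquiv (q := (· ≠ σ i)) fun _ => σ.injective.ne_iff.symm).trans
      (finSuccAboveEquiv (σ i)).symm

theorem succAbove_inducedPerm {n : ℕ} (σ : Equiv.Perm (Fin (n + 1))) (i : Fin (n + 1))
    (j : Fin n) : (σ i).succAbove (inducedPerm σ i j) = σ (i.succAbove j) :=
  congrArg Subtype.val ((finSuccAboveEquiv (σ i)).apply_symm_apply
    ⟨σ (i.succAbove j), σ.injective.ne (i.succAbove_ne j)⟩)

theorem sign_mul_koszul_eq_prod_succAbove {n : ℕ} (d : Fin (n + 1) → ℤ)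
    (σ : Equiv.Perm (Fin (n + 1))) (i : Fin (n + 1)) :
    σ.sign * koszul d σ =
      (∏ j, if i < i.succAbove j ↔ σ i < σ (i.succAbove j) then 1
        else swapSign (d (σ i)) (d (σ (i.succAbove j)))) *
      ((inducedPerm σ i).sign * koszul ((σ i).removeNth d) (inducedPerm σ i)) := by
  have h_pair (j : Fin n) :
      ((if i < i.succAbove j ∧ σ (i.succAbove j) < σ i then
          swapSign (d (σ i)) (d (σ (i.succAbove j))) else 1) *
        if i.succAbove j < i ∧ σ i < σ (i.succAbove j) then
          swapSign (d (σ (i.succAbove j))) (d (σ i)) else 1) =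
      if i < i.succAbove j ↔ σ i < σ (i.succAbove j) then 1
        else swapSign (d (σ i)) (d (σ (i.succAbove j))) := by
    rw [swapSign_comm (d (σ (i.succAbove j)))]
    rcases (i.succAbove_ne j).lt_or_gt with h | h <;>
      rcases (σ.injective.ne (i.succAbove_ne j)).lt_or_gt with hσ | hσ <;>
        simp [h, hσ, h.not_gt, hσ.not_gt]
  rw [sign_mul_koszul, sign_mul_koszul, Fin.prod_univ_succAbove _ i, Fin.prod_univ_succAbove _ i]
  simp only [Fin.prod_univ_succAbove _ i, prod_mul_distrib, lt_self_iff_false, false_and, if_false,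
    one_mul, ← mul_assoc, ← h_pair, Fin.removeNth_apply, succAbove_inducedPerm,
    Fin.succAbove_lt_succAbove_iff]
  simp only [← succAbove_inducedPerm, Fin.succAbove_lt_succAbove_iff]

/-- Both sides are products of `swapSign`s over the pairs of letters that get reversed, and they
differ only by pairs that are reversed twice. -/
theorem sign_mul_koszul_mul_moveSign {n : ℕ} (d : Fin (n + 1) → ℤ) (σ : Equiv.Perm (Fin (n + 1)))
    (i : Fin (n + 1)) :
    σ.sign * koszul d σ * moveSign (fun j => d (σ j)) i =
      moveSign d (σ i) *
        ((inducedPerm σ i).sign * koszul ((σ i).removeNth d) (inducedPerm σ i)) := by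
  have h_moveSign : moveSign d (σ i) =
      ∏ j, if σ i < σ (i.succAbove j) then swapSign (d (σ i)) (d (σ (i.succAbove j))) else 1 := by
    rw [moveSign_eq_prod_succAbove, ← Equiv.prod_comp (inducedPerm σ i)]
    simp only [succAbove_inducedPerm]
  rw [sign_mul_koszul_eq_prod_succAbove d σ i, mul_right_comm, h_moveSign,
    moveSign_eq_prod_succAbove, ← prod_mul_distrib]
  congr 1
  refine prod_congr rfl fun j _ => ?_
  by_cases h : i < i.succAbove j <;> by_cases hσ : σ i < σ (i.succAbove j) <;>
    simp [h, hσ, Int.units_mul_self]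

end Signs

section MixedBracket

variable {R : Type*} [CommRing R] {V W U : Type*} [AddCommGroup V] [Module R V]
  [AddCommGroup W] [Module R W] [AddCommGroup U] [Module R U] {n : ℕ}

/-- The multilinear extension of
`((v_i, w_i))_i ↦ f (v_0, …, v_n) + ∑ i, ± φ (w_0, …, w_{i-1}, w_{i+1}, …, w_n) v_i`
with the signs that are right for letters of degrees `d`. For `f = μ_k` and `φ = ψ_k` its values are
the first components of the bicrossed product. -/
def mixedBracket (f : MultilinearMap R (fun _ : Fin (n + 1) => V) U)
    (φ : MultilinearMap R (fun _ : Fin n => W) (V →ₗ[R] U)) (d : Fin (n + 1) → ℤ) :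
    MultilinearMap R (fun _ : Fin (n + 1) => V × W) U :=
  f.compLinearMap (fun _ => LinearMap.fst R V W) + ∑ i, moveSign d i • insertAction i φ

theorem mixedBracket_apply (f : MultilinearMap R (fun _ : Fin (n + 1) => V) U)
    (φ : MultilinearMap R (fun _ : Fin n => W) (V →ₗ[R] U)) (d : Fin (n + 1) → ℤ)
    (z : Fin (n + 1) → V × W) :
    mixedBracket f φ d z = f (fun i => (z i).1) +
      ∑ i, moveSign d i • φ (i.removeNth fun j => (z j).2) (z i).1 := by
  simp [mixedBracket, insertAction_apply]

theorem mixedBracket_mem {𝒢 : ℤ → Submodule R V} {ℋ : ℤ → Submodule R W} {𝒰 : ℤ → Submodule R U}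
    {f : MultilinearMap R (fun _ : Fin (n + 1) => V) U}
    {φ : MultilinearMap R (fun _ : Fin n => W) (V →ₗ[R] U)} {c : ℤ}
    (hf : ∀ (d : Fin (n + 1) → ℤ) (v : Fin (n + 1) → V), (∀ i, v i ∈ 𝒢 (d i)) →
      f v ∈ 𝒰 ((∑ i, d i) + c))
    (hφ : ∀ (d : Fin n → ℤ) (e : ℤ) (w : Fin n → W) (v : V), (∀ i, w i ∈ ℋ (d i)) → v ∈ 𝒢 e →
      φ w v ∈ 𝒰 ((∑ i, d i) + e + c))
    {d : Fin (n + 1) → ℤ} {z : Fin (n + 1) → V × W} (hz : ∀ i, z i ∈ (𝒢 (d i)).prod (ℋ (d i))) :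
    mixedBracket f φ d z ∈ 𝒰 ((∑ i, d i) + c) := by
  rw [mixedBracket_apply]
  refine add_mem (hf d _ fun i => (hz i).1) (sum_mem fun i _ => ?_)
  rw [Fin.sum_univ_succAbove d i, add_comm (d i)]
  exact Submodule.smul_of_tower_mem _ _ (hφ (i.removeNth d) (d i) _ _ (fun j => (hz _).2) (hz i).1)

end MixedBracket

section Bicrossed

variable {K : Type*} [Field K]
  {V : Type*} [AddCommGroup V] [Module K V] {W : Type*} [AddCommGroup W] [Module K W]

theorem mixedBracket_perm {U : Type*} [AddCommGroup U] [Module K U] {n : ℕ}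
    {𝒢 : ℤ → Submodule K V} {ℋ : ℤ → Submodule K W}
    {f : MultilinearMap K (fun _ : Fin (n + 1) => V) U}
    {φ : MultilinearMap K (fun _ : Fin n => W) (V →ₗ[K] U)} (hf : IsGradedSkew 𝒢 f)
    (hφ : IsGradedSkew ℋ φ) {d : Fin (n + 1) → ℤ} {z : Fin (n + 1) → V × W}
    (hz : ∀ i, z i ∈ sumGrading 𝒢 ℋ (d i)) (σ : Equiv.Perm (Fin (n + 1))) :
    mixedBracket f φ d z =
      (σ.sign * koszul d σ) • mixedBracket f φ (fun i => d (σ i)) fun i => z (σ i) := by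
  rw [mixedBracket_apply, mixedBracket_apply, hf d _ (fun i => (hz i).1) σ, smul_add, smul_sum,
    ← Equiv.sum_comp σ]
  congr 1
  refine sum_congr rfl fun i _ => ?_
  rw [smul_smul, sign_mul_koszul_mul_moveSign,
    hφ ((σ i).removeNth d) ((σ i).removeNth fun j => (z j).2) (fun j => (hz _).2) (inducedPerm σ i),
    LinearMap.smul_apply, smul_smul]
  simp only [Fin.removeNth_apply, succAbove_inducedPerm]
  rfl

/-- The multilinear extension of the `(n + 1)`-ary operation of the bicrossed product from letters
of degrees `d`. -/
def bicrossedBracket (μ : Brackets K V) (ν : Brackets K W) (ρ : Actions K V W)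
    (ψ : Actions K W V) (n : ℕ) (d : Fin (n + 1) → ℤ) :
    MultilinearMap K (fun _ : Fin (n + 1) => V × W) (V × W) :=
  (mixedBracket (μ n) (ψ n) d).prod <|
    (mixedBracket (ν n) (ρ n) d).compLinearMap fun _ => (LinearEquiv.prodComm K V W).toLinearMap

section

variable (μ : Brackets K V) (ν : Brackets K W) (ρ : Actions K V W) (ψ : Actions K W V)

theorem bicrossedBracket_apply (n : ℕ) (d : Fin (n + 1) → ℤ) (z : Fin (n + 1) → V × W) :
    bicrossedBracket μ ν ρ ψ n d z =
      (mixedBracket (μ n) (ψ n) d z, mixedBracket (ν n) (ρ n) d fun i => (z i).swap) := rfl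

theorem bicrossedBracket_eq_ltimes_add_rtimes (n : ℕ) (d : Fin (n + 1) → ℤ)
    (z : Fin (n + 1) → V × W) :
    bicrossedBracket μ ν ρ ψ n d z = ltimes μ ρ n d (fun i => (z i).1) (fun i => (z i).2) +
      rtimes ψ ν n d (fun i => (z i).1) fun i => (z i).2 := by
  rw [bicrossedBracket_apply, mixedBracket_apply, mixedBracket_apply, add_comm (ν n _)]
  rfl

theorem existsUnique_isBicrossed {𝒢 : ℤ → Submodule K V} {ℋ : ℤ → Submodule K W}
    (h𝒢 : DirectSum.IsInternal 𝒢) (hℋ : DirectSum.IsInternal ℋ) :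
    ∃! l : Brackets K (V × W), IsBicrossed 𝒢 μ ℋ ν ρ ψ l := by
  have h_glue (n : ℕ) : ∃! f : MultilinearMap K (fun _ : Fin (n + 1) => V × W) (V × W),
      ∀ (d : Fin (n + 1) → ℤ) (z : Fin (n + 1) → V × W), (∀ i, z i ∈ sumGrading 𝒢 ℋ (d i)) →
        f z = bicrossedBracket μ ν ρ ψ n d z :=
    existsUnique_multilinearMap_eqOn_homogeneous (fun _ => isInternal_prod h𝒢 hℋ) _
  simp only [bicrossedBracket_eq_ltimes_add_rtimes] at h_glue
  choose l hl hl_unique using h_glue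
  exact ⟨l, hl, fun l' hl' => funext fun n => hl_unique n (l' n) (hl' n)⟩

end

section Composition

variable (μ : Brackets K V) (ν : Brackets K W) (ρ : Actions K V W) (ψ : Actions K W V)

theorem moveSign_cons_zero {a : ℕ} (e : ℤ) (d : Fin a → ℤ) :
    moveSign (Fin.cons e d) (0 : Fin (a + 1)) = ((a : ℤ) + e * ∑ j, d j).negOnePow := by
  simp [moveSign, sum_filter, Fin.sum_univ_succ]

theorem moveSign_cons_succ {a : ℕ} (e : ℤ) (d : Fin a → ℤ) (j : Fin a) :
    moveSign (Fin.cons e d) j.succ =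
      ((a : ℤ) - 1 - (j : ℕ) + d j * ∑ j' with j < j', d j').negOnePow := by
  have : (a : ℤ) - 1 - (j : ℕ) = (a : ℤ) - ((j : ℕ) + 1) := by ring
  simp [moveSign, sum_filter, Fin.sum_univ_succ, this]

theorem exists_linearMap_cons {R M U : Type*} [CommSemiring R] [AddCommMonoid M] [Module R M]
    [AddCommMonoid U] [Module R U] {a : ℕ} (f : MultilinearMap R (fun _ : Fin (a + 1) => M) U)
    (v : Fin a → M) :
    ∃ L : M →ₗ[R] U, ∀ y, f (Fin.cons y v) = L y :=
  ⟨f.toLinearMap (Fin.cons 0 v) 0, fun y => by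
    rw [MultilinearMap.toLinearMap_apply, Fin.update_cons_zero]⟩

theorem exists_linearMap_removeNth_succ_cons {R M U : Type*} [CommSemiring R] [AddCommMonoid M]
    [Module R M] [AddCommMonoid U] [Module R U] {a : ℕ}
    (f : MultilinearMap R (fun _ : Fin a => M) U) (v : Fin a → M) (j : Fin a) :
    ∃ L : M →ₗ[R] U, ∀ y, f (j.succ.removeNth (Fin.cons y v : Fin (a + 1) → M)) = L y := by
  cases a with
  | zero => exact j.elim0
  | succ a =>
    obtain ⟨L, hL⟩ := exists_linearMap_cons f (j.removeNth v)
    refine ⟨L, fun y => ?_⟩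
    rw [← hL, ← Fin.cons_comp_succ_succAbove]
    rfl

theorem mixedBracket_cons_bicrossedBracket {a b : ℕ} (d : Fin (b + 1) → ℤ) (d' : Fin a → ℤ)
    (z : Fin (b + 1) → V × W) (z' : Fin a → V × W) :
    mixedBracket (μ a) (ψ a) (Fin.cons ((∑ i, d i) + ((b : ℤ) + 1 - 2)) d')
        (Fin.cons (bicrossedBracket μ ν ρ ψ b d z) z') =
      compatSummand μ ν ρ ψ d d' (fun i => (z i).1) (fun i => (z' i).1)
        (fun i => (z i).2) fun i => (z' i).2 := by
  obtain ⟨M, hM⟩ := exists_linearMap_cons (μ a) fun j => (z' j).1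
  choose L hL using exists_linearMap_removeNth_succ_cons (ψ a) fun j => (z' j).2
  have h_fst (y : V × W) : (fun i => ((Fin.cons y z' : Fin (a + 1) → V × W) i).1) =
      Fin.cons y.1 fun j => (z' j).1 := Fin.comp_cons Prod.fst y z'
  have h_snd (y : V × W) : (fun i => ((Fin.cons y z' : Fin (a + 1) → V × W) i).2) =
      Fin.cons y.2 fun j => (z' j).2 := Fin.comp_cons Prod.snd y z'
  rw [mixedBracket_apply, h_fst, h_snd, Fin.sum_univ_succ, moveSign_cons_zero]
  simp only [moveSign_cons_succ, bicrossedBracket_apply, mixedBracket_apply, Fin.cons_zero,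
    Fin.cons_succ, Fin.removeNth_zero, Fin.tail_cons, hL, hM, compatSummand, map_add, map_sum,
    LinearMap.map_smul_of_tower, LinearMap.add_apply, LinearMap.sum_apply, LinearMap.smul_apply,
    smul_add, smul_sum, smul_smul, sum_add_distrib]
  simp only [mul_comm, Prod.fst_swap, Prod.snd_swap]
  abel

theorem bicrossedBracket_cons {a b : ℕ} (d : Fin (b + 1) → ℤ) (d' : Fin a → ℤ)
    (z : Fin (b + 1) → V × W) (z' : Fin a → V × W) :
    bicrossedBracket μ ν ρ ψ a (Fin.cons ((∑ i, d i) + ((b : ℤ) + 1 - 2)) d')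
        (Fin.cons (bicrossedBracket μ ν ρ ψ b d z) z') =
      (compatSummand μ ν ρ ψ d d' (fun i => (z i).1) (fun i => (z' i).1)
          (fun i => (z i).2) fun i => (z' i).2,
        compatSummand ν μ ψ ρ d d' (fun i => (z i).2) (fun i => (z' i).2)
          (fun i => (z i).1) fun i => (z' i).1) := by
  rw [bicrossedBracket_apply, mixedBracket_cons_bicrossedBracket]
  congr 1
  exact (congrArg _ (Fin.comp_cons Prod.swap _ z')).trans
    (mixedBracket_cons_bicrossedBracket ν μ ψ ρ d d' (fun i => (z i).swap) fun i => (z' i).swap)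

end Composition

variable {𝒢 : ℤ → Submodule K V} {μ : Brackets K V} {ℋ : ℤ → Submodule K W}
  {ν : Brackets K W} {ρ : Actions K V W} {ψ : Actions K W V} {l : Brackets K (V × W)} {n : ℕ}
  {d : Fin (n + 1) → ℤ} {z : Fin (n + 1) → V × W}

theorem IsBicrossed.eq_bicrossedBracket (hl : IsBicrossed 𝒢 μ ℋ ν ρ ψ l)
    (hz : ∀ i, z i ∈ sumGrading 𝒢 ℋ (d i)) : l n z = bicrossedBracket μ ν ρ ψ n d z :=
  (hl n d z hz).trans (bicrossedBracket_eq_ltimes_add_rtimes μ ν ρ ψ n d z).symm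

theorem bicrossedBracket_mem (hP : IsMatchedPair 𝒢 μ ℋ ν ρ ψ)
    (hz : ∀ i, z i ∈ sumGrading 𝒢 ℋ (d i)) :
    bicrossedBracket μ ν ρ ψ n d z ∈ sumGrading 𝒢 ℋ ((∑ i, d i) + ((n : ℤ) + 1 - 2)) :=
  ⟨mixedBracket_mem (hP.left.degree n) (hP.rep_right.degree n) hz,
    mixedBracket_mem (hP.right.degree n) (hP.rep_left.degree n) fun i => (hz i).symm⟩

theorem bicrossedBracket_perm (hP : IsMatchedPair 𝒢 μ ℋ ν ρ ψ)
    (hz : ∀ i, z i ∈ sumGrading 𝒢 ℋ (d i)) (σ : Equiv.Perm (Fin (n + 1))) :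
    bicrossedBracket μ ν ρ ψ n d z = (σ.sign * koszul d σ) •
      bicrossedBracket μ ν ρ ψ n (fun i => d (σ i)) fun i => z (σ i) :=
  Prod.ext (mixedBracket_perm (hP.left.skew n) (hP.rep_right.skew n) hz σ)
    (mixedBracket_perm (hP.right.skew n) (hP.rep_left.skew n) (fun i => (hz i).symm) σ)

theorem IsBicrossed.apply_cons_apply (hl : IsBicrossed 𝒢 μ ℋ ν ρ ψ l)
    (hP : IsMatchedPair 𝒢 μ ℋ ν ρ ψ) {a : ℕ} {d' : Fin a → ℤ} {z' : Fin a → V × W}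
    (hz : ∀ i, z i ∈ sumGrading 𝒢 ℋ (d i)) (hz' : ∀ i, z' i ∈ sumGrading 𝒢 ℋ (d' i)) :
    l a (Fin.cons (l n z) z') =
      (compatSummand μ ν ρ ψ d d' (fun i => (z i).1) (fun i => (z' i).1)
          (fun i => (z i).2) fun i => (z' i).2,
        compatSummand ν μ ψ ρ d d' (fun i => (z i).2) (fun i => (z' i).2)
          (fun i => (z i).1) fun i => (z' i).1) := by
  rw [hl.eq_bicrossedBracket hz, ← bicrossedBracket_cons]
  exact hl.eq_bicrossedBracket (Fin.cases (bicrossedBracket_mem hP hz) hz')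

theorem IsBicrossed.jacobiTerm_eq (hl : IsBicrossed 𝒢 μ ℋ ν ρ ψ l)
    (hP : IsMatchedPair 𝒢 μ ℋ ν ρ ψ) {a b : ℕ} {d : Fin (b + 1 + a) → ℤ}
    {z : Fin (b + 1 + a) → V × W} (hz : ∀ i, z i ∈ sumGrading 𝒢 ℋ (d i)) :
    jacobiTerm l a b d z =
      (compatTerm μ ν ρ ψ a b d (fun i => (z i).1) fun i => (z i).2,
        compatTerm ν μ ψ ρ a b d (fun i => (z i).2) fun i => (z i).1) := by
  have h_comp (σ : Equiv.Perm (Fin (b + 1 + a))) :=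
    hl.apply_cons_apply hP (fun i => hz (σ (Fin.castAdd a i)))
      fun j => hz (σ (Fin.natAdd (b + 1) j))
  simp only [jacobiTerm, compatTerm, h_comp, Prod.smul_mk, prod_mk_sum]

theorem IsBicrossed.isLInfinityAlgebra (hl : IsBicrossed 𝒢 μ ℋ ν ρ ψ l)
    (hP : IsMatchedPair 𝒢 μ ℋ ν ρ ψ) : IsLInfinityAlgebra (sumGrading 𝒢 ℋ) l where
  isInternal := isInternal_prod hP.left.isInternal hP.right.isInternal
  degree n d z hz := by
    rw [hl.eq_bicrossedBracket hz]
    exact bicrossedBracket_mem hP hz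
  skew n d z hz σ := by
    rw [hl.eq_bicrossedBracket hz, hl.eq_bicrossedBracket fun i => hz (σ i)]
    exact bicrossedBracket_perm hP hz σ
  jacobi n d z hz := by
    have h_jacobiTerm (p : {p // p ∈ antidiagonal n}) :=
      hl.jacobiTerm_eq hP (z := fun i => z (Fin.cast (arity p) i)) fun i => hz _
    simp only [h_jacobiTerm, ← prod_mk_sum]
    exact Prod.ext
      (hP.compat_left n d (fun i => (z i).1) (fun i => (z i).2) (fun i => (hz i).1)
        fun i => (hz i).2)
      (hP.compat_right n d (fun i => (z i).1) (fun i => (z i).2) (fun i => (hz i).1)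
        fun i => (hz i).2)

end Bicrossed

section ZeroLetter

variable {K : Type*} [Field K]
  {V : Type*} [AddCommGroup V] [Module K V] {W : Type*} [AddCommGroup W] [Module K W]
  {a b : ℕ}

theorem map_cons_map_eq_zero {R M U : Type*} [CommSemiring R] [AddCommMonoid M] [Module R M]
    [AddCommMonoid U] [Module R U] (f : MultilinearMap R (fun _ : Fin (a + 1) => M) U)
    (g : MultilinearMap R (fun _ : Fin (b + 1) => M) M) {x : Fin (b + 1 + a) → M}
    {i : Fin (b + 1 + a)} (hi : x i = 0) :
    f (Fin.cons (g fun j => x (Fin.castAdd a j)) fun j => x (Fin.natAdd (b + 1) j)) = 0 := by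
  induction i using Fin.addCases with
  | left i => exact f.map_coord_zero 0 (g.map_coord_zero i hi)
  | right j => exact f.map_coord_zero j.succ hi

theorem jacobiTerm_eq_zero (μ : Brackets K V) (d : Fin (b + 1 + a) → ℤ)
    {x : Fin (b + 1 + a) → V} {i : Fin (b + 1 + a)} (hi : x i = 0) :
    jacobiTerm μ a b d x = 0 :=
  sum_eq_zero fun σ _ => by
    rw [map_cons_map_eq_zero (x := fun j => x (σ j)) (i := σ.symm i) (μ a) (μ b) (by simpa),
      smul_zero]

theorem compatTerm_eq_sum_mixedBracket (μ : Brackets K V) (ν : Brackets K W) (ρ : Actions K V W)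
    (ψ : Actions K W V) (d : Fin (b + 1 + a) → ℤ) (z : Fin (b + 1 + a) → V × W) :
    compatTerm μ ν ρ ψ a b d (fun i => (z i).1) (fun i => (z i).2) =
      ∑ σ ∈ shuffles (b + 1) a, (σ.sign * koszul d σ * (((b + 1) * a : ℕ) : ℤ).negOnePow) •
        mixedBracket (μ a) (ψ a)
          (Fin.cons ((∑ i, d (σ (Fin.castAdd a i))) + ((b : ℤ) + 1 - 2))
            fun j => d (σ (Fin.natAdd (b + 1) j)))
          (Fin.cons
            (bicrossedBracket μ ν ρ ψ b (fun i => d (σ (Fin.castAdd a i)))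
              fun i => z (σ (Fin.castAdd a i)))
            fun j => z (σ (Fin.natAdd (b + 1) j))) := by
  simp only [mixedBracket_cons_bicrossedBracket, compatTerm]

theorem compatTerm_eq_zero (μ : Brackets K V) (ν : Brackets K W) (ρ : Actions K V W)
    (ψ : Actions K W V) (d : Fin (b + 1 + a) → ℤ) {z : Fin (b + 1 + a) → V × W}
    {i : Fin (b + 1 + a)} (hi : z i = 0) :
    compatTerm μ ν ρ ψ a b d (fun i => (z i).1) (fun i => (z i).2) = 0 := by
  rw [compatTerm_eq_sum_mixedBracket]
  refine sum_eq_zero fun σ _ => ?_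
  rw [map_cons_map_eq_zero (x := fun j => z (σ j)) (i := σ.symm i) _ _ (by simpa), smul_zero]

theorem repTermInner_eq_zero (ρ : Actions K V W) (d : Fin (b + 1 + a) → ℤ)
    {x : Fin (b + 1 + a) → V} (h : W) {i : Fin (b + 1 + a)} (hi : (i : ℕ) ≠ b + a)
    (hx : x i = 0) : repTermInner ρ a b d x h = 0 := by
  refine sum_eq_zero fun σ hσ => ?_
  obtain ⟨j, rfl⟩ := σ.surjective i
  induction j using Fin.addCases with
  | left j =>
    induction j using Fin.lastCases with
    | last => exact absurd (mem_filter.1 hσ).2 hi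
    | cast j =>
      rw [(ρ b).map_coord_zero j hx, LinearMap.zero_apply, map_zero, smul_zero]
  | right j => rw [(ρ a).map_coord_zero j hx, LinearMap.zero_apply, smul_zero]

theorem repTermOuter_eq_zero (μ : Brackets K V) (ρ : Actions K V W) (d : Fin (b + 1 + a) → ℤ)
    {x : Fin (b + 1 + a) → V} (h : W) {i : Fin (b + 1 + a)} (hi : (i : ℕ) ≠ b + a)
    (hx : x i = 0) : repTermOuter μ ρ a b d x h = 0 := by
  cases a with
  | zero => rfl
  | succ a =>
    refine sum_eq_zero fun σ hσ => ?_
    suffices h_inputs : ρ (a + 1) (Fin.cons (μ b fun i => x (σ (Fin.castAdd (a + 1) i)))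
        fun j : Fin a => x (σ (Fin.natAdd (b + 1) j.castSucc))) = 0 by
      rw [h_inputs, LinearMap.zero_apply, smul_zero]
    obtain ⟨j, rfl⟩ := σ.surjective i
    induction j using Fin.addCases with
    | left j => exact (ρ (a + 1)).map_coord_zero 0 ((μ b).map_coord_zero j hx)
    | right j =>
      induction j using Fin.lastCases with
      | last =>
        refine absurd ?_ hi
        rw [Fin.natAdd_last, (mem_filter.1 hσ).2, Fin.val_last]
        omega
      | cast j => exact (ρ (a + 1)).map_coord_zero j.succ hx

end ZeroLetter

section DegreeZero

variable {K : Type*} [Field K] {V : Type*} [AddCommGroup V] [Module K V]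

theorem mem_degreeZero {i : ℤ} {x : V} : x ∈ degreeZero K V i ↔ i = 0 ∨ x = 0 := by
  unfold degreeZero
  split_ifs with h <;> simp [h]

theorem isInternal_degreeZero (K V : Type*) [Field K] [AddCommGroup V] [Module K V] :
    DirectSum.IsInternal (degreeZero K V) := by
  rw [DirectSum.isInternal_submodule_iff_iSupIndep_and_iSup_eq_top]
  refine ⟨fun i => ?_, top_le_iff.1 (le_iSup_of_le 0 (by simp [degreeZero]))⟩
  rcases eq_or_ne i 0 with rfl | hi
  · have h_rest : ⨆ j, ⨆ _ : j ≠ 0, degreeZero K V j = ⊥ :=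
      le_bot_iff.1 (iSup₂_le fun j hj => by simp [degreeZero, hj])
    rw [h_rest]
    exact disjoint_bot_right
  · simp [degreeZero, hi]

theorem eq_zero_or_exists_eq_zero {n : ℕ} {d : Fin n → ℤ} {x : Fin n → V}
    (hx : ∀ i, x i ∈ degreeZero K V (d i)) : d = 0 ∨ ∃ i, d i ≠ 0 ∧ x i = 0 := by
  by_contra! h
  obtain ⟨i, hi⟩ := Function.ne_iff.1 h.1
  exact h.2 i hi ((mem_degreeZero.1 (hx i)).resolve_left hi)

theorem koszul_zero {n : ℕ} (σ : Equiv.Perm (Fin n)) : koszul 0 σ = 1 := by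
  simp [koszul]

theorem isGradedSkew_degreeZero {U : Type*} [AddCommGroup U] [Module K U] {n : ℕ}
    {f : MultilinearMap K (fun _ : Fin n => V) U}
    (hf : ∀ (x : Fin n → V) (σ : Equiv.Perm (Fin n)), f x = σ.sign • f fun i => x (σ i)) :
    IsGradedSkew (degreeZero K V) f := by
  intro d x hx σ
  rcases eq_zero_or_exists_eq_zero hx with rfl | ⟨i, -, hi⟩
  · rw [koszul_zero, mul_one]
    exact hf x σ
  · rw [f.map_coord_zero i hi, f.map_coord_zero (σ.symm i) (by simpa), smul_zero]

theorem sum_shuffles_two_one_degreeZero {A : Type*} [AddCommGroup A]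
    (F : Equiv.Perm (Fin (2 + 1)) → A) :
    ∑ σ ∈ shuffles 2 1, (σ.sign * koszul 0 σ * ((2 * 1 : ℕ) : ℤ).negOnePow) • F σ =
      F 1 - F (Equiv.swap 1 2) + F (finRotate 3) := by
  have h_shuffles : shuffles 2 1 = {1, Equiv.swap 1 2, finRotate 3} := by decide
  have h_swap : Equiv.Perm.sign (Equiv.swap (1 : Fin 3) 2) = -1 := by decide
  have h_rotate : Equiv.Perm.sign (finRotate 3) = 1 := by decide
  have h_two : Int.negOnePow 2 = 1 := rfl
  rw [h_shuffles, sum_insert (by decide), sum_pair (by decide)]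
  simp only [h_swap, h_rotate, Equiv.Perm.sign_one, koszul_zero, mul_one, Nat.cast_ofNat, h_two,
    one_smul, Units.neg_smul]
  abel

end DegreeZero

section Lie

variable {K : Type*} [Field K] {g h : Type*} [LieRing g] [LieAlgebra K g] [LieRing h]
  [LieAlgebra K h]

theorem lieBrackets_of_ne {n : ℕ} (hn : n ≠ 1) : lieBrackets K g n = 0 := by
  match n, hn with
  | 0, _ => rfl
  | n + 2, _ => rfl

theorem lieActions_of_ne (ρ : g →ₗ[K] Module.End K h) {n : ℕ} (hn : n ≠ 1) :
    lieActions ρ n = 0 := by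
  match n, hn with
  | 0, _ => rfl
  | n + 2, _ => rfl

theorem isGradedSkew_lieBrackets (n : ℕ) :
    IsGradedSkew (degreeZero K g) (lieBrackets K g n) := by
  refine isGradedSkew_degreeZero fun x σ => ?_
  by_cases hn : n = 1
  · subst hn
    obtain rfl | rfl : σ = 1 ∨ σ = Equiv.swap 0 1 := by decide +revert
    · simp
    · simp [lieBrackets_one]
  · simp [lieBrackets_of_ne hn]

theorem isGradedSkew_lieActions (ρ : g →ₗ[K] Module.End K h) (n : ℕ) :
    IsGradedSkew (degreeZero K g) (lieActions ρ n) := by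
  refine isGradedSkew_degreeZero fun x σ => ?_
  by_cases hn : n = 1
  · subst hn
    simp [Subsingleton.elim σ 1]
  · simp [lieActions_of_ne ρ hn]

theorem lie_lie_sub_lie_lie_add_lie_lie (x y z : g) :
    ⁅⁅x, y⁆, z⁆ - ⁅⁅x, z⁆, y⁆ + ⁅⁅y, z⁆, x⁆ = 0 := by
  rw [lie_lie x y z, ← lie_skew ⁅x, z⁆ y, ← lie_skew ⁅y, z⁆ x]
  abel

theorem jacobiTerm_lieBrackets (a b : ℕ) {d : Fin (b + 1 + a) → ℤ} {x : Fin (b + 1 + a) → g}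
    (hx : ∀ i, x i ∈ degreeZero K g (d i)) : jacobiTerm (lieBrackets K g) a b d x = 0 := by
  rcases eq_zero_or_exists_eq_zero hx with rfl | ⟨i, -, hi⟩
  · by_cases hab : a = 1 ∧ b = 1
    · obtain ⟨rfl, rfl⟩ := hab
      exact (sum_shuffles_two_one_degreeZero _).trans
        (lie_lie_sub_lie_lie_add_lie_lie (x 0) (x 1) (x 2))
    · rcases not_and_or.1 hab with ha | hb
      · simp [jacobiTerm, lieBrackets_of_ne ha]
      · simp [jacobiTerm, lieBrackets_of_ne hb, MultilinearMap.map_coord_zero _ (0 : Fin (a + 1))]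
  · exact jacobiTerm_eq_zero _ d hi

theorem isLInfinityAlgebra_lieBrackets :
    IsLInfinityAlgebra (degreeZero K g) (lieBrackets K g) where
  isInternal := isInternal_degreeZero K g
  degree n d x hx := by
    rw [mem_degreeZero]
    by_cases hn : n = 1
    · subst hn
      rcases eq_zero_or_exists_eq_zero hx with rfl | ⟨i, -, hi⟩
      · exact Or.inl (by simp)
      · exact Or.inr (MultilinearMap.map_coord_zero _ i hi)
    · exact Or.inr (by simp [lieBrackets_of_ne hn])
  skew := isGradedSkew_lieBrackets
  jacobi n d x hx := sum_eq_zero fun p _ => jacobiTerm_lieBrackets _ _ fun i => hx _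

theorem repTermInner_lieActions (ρ : g →ₗ[K] Module.End K h) (x : Fin (2 + 1) → g) (u : h) :
    repTermInner (lieActions ρ) 1 1 0 x u = ρ (x 1) (ρ (x 0) u) - ρ (x 0) (ρ (x 1) u) := by
  have h_shuffles : ({σ ∈ shuffles 2 1 | (σ 1 : ℕ) = 2} : Finset (Equiv.Perm (Fin (2 + 1)))) =
    {Equiv.swap 1 2, finRotate 3} := by decide
  have h_swap : Equiv.Perm.sign (Equiv.swap (1 : Fin 3) 2) = -1 := by decide
  have h_swap_zero : Equiv.swap (1 : Fin 3) 2 0 = 0 := by decide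
  have h_rotate : Equiv.Perm.sign (finRotate 3) = 1 := by decide
  have h_two : Int.negOnePow 2 = 1 := rfl
  have h_sum : repTermInner (lieActions ρ) 1 1 0 x u = _ := sum_congr h_shuffles fun _ _ => rfl
  rw [h_sum, sum_pair (by decide)]
  simp [koszul_zero, lieActions_one, h_swap, h_swap_zero, h_rotate, h_two, sub_eq_add_neg]

theorem repTermOuter_lieActions (ρ : g →ₗ[K] Module.End K h) (x : Fin (2 + 1) → g) (u : h) :
    repTermOuter (lieBrackets K g) (lieActions ρ) 1 1 0 x u = ρ ⁅x 0, x 1⁆ u := by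
  have h_shuffles : ({σ ∈ shuffles 2 1 | σ 2 = 2} : Finset (Equiv.Perm (Fin (2 + 1)))) = {1} := by
    decide
  have h_two : Int.negOnePow 2 = 1 := rfl
  have h_sum : repTermOuter (lieBrackets K g) (lieActions ρ) 1 1 0 x u = _ :=
    sum_congr h_shuffles fun _ _ => rfl
  rw [h_sum, sum_singleton]
  simp [koszul_zero, lieBrackets_one, lieActions_one, h_two]

theorem repTermInner_add_repTermOuter_lieActions {ρ : g →ₗ[K] Module.End K h}
    (hρ : ∀ (x y : g) (u : h), ρ ⁅x, y⁆ u = ρ x (ρ y u) - ρ y (ρ x u)) (a b : ℕ)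
    {d : Fin (b + 1 + a) → ℤ} {x : Fin (b + 1 + a) → g} {u : h}
    (hx : ∀ i, x i ∈ degreeZero K g (d i))
    (hu : ∀ i : Fin (b + 1 + a), (i : ℕ) = b + a → u ∈ degreeZero K h (d i)) :
    repTermInner (lieActions ρ) a b d x u +
      repTermOuter (lieBrackets K g) (lieActions ρ) a b d x u = 0 := by
  rcases eq_zero_or_exists_eq_zero hx with rfl | ⟨i, hdi, hi⟩
  · by_cases hab : a = 1 ∧ b = 1
    · obtain ⟨rfl, rfl⟩ := hab
      rw [repTermInner_lieActions, repTermOuter_lieActions, hρ]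
      abel
    · rcases not_and_or.1 hab with ha | hb
      · cases a <;> simp [repTermInner, repTermOuter, lieActions_of_ne ρ ha]
      · cases a <;> simp [repTermInner, repTermOuter, lieBrackets_of_ne hb, lieActions_of_ne ρ hb,
          MultilinearMap.map_coord_zero _ (0 : Fin (_ + 1))]
  · by_cases hi_last : (i : ℕ) = b + a
    · obtain rfl := (mem_degreeZero.1 (hu i hi_last)).resolve_left hdi
      cases a <;> simp [repTermInner, repTermOuter]
    · rw [repTermInner_eq_zero _ d u hi_last hi, repTermOuter_eq_zero _ _ d u hi_last hi, add_zero]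

theorem isRepresentation_lieActions {ρ : g →ₗ[K] Module.End K h}
    (hρ : ∀ (x y : g) (u : h), ρ ⁅x, y⁆ u = ρ x (ρ y u) - ρ y (ρ x u)) :
    IsRepresentation (degreeZero K g) (lieBrackets K g) (degreeZero K h) (lieActions ρ) where
  isInternal := isInternal_degreeZero K h
  degree n d e x u hx hu := by
    rw [mem_degreeZero]
    by_cases hn : n = 1
    · subst hn
      rcases mem_degreeZero.1 hu with rfl | rfl
      · rcases eq_zero_or_exists_eq_zero hx with rfl | ⟨i, -, hi⟩
        · exact Or.inl (by simp)
        · exact Or.inr (by simp [MultilinearMap.map_coord_zero _ i hi])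
      · exact Or.inr (map_zero _)
    · exact Or.inr (by simp [lieActions_of_ne ρ hn])
  skew := isGradedSkew_lieActions ρ
  identity n d x u hx hu := by
    rw [← sum_add_distrib]
    refine sum_eq_zero fun p _ =>
      repTermInner_add_repTermOuter_lieActions hρ _ _ (fun i => hx _) fun i hi => ?_
    have h_last : Fin.cast (arity p) i = Fin.last n := by
      have h_arity := arity p
      ext
      simp only [Fin.val_cast, Fin.val_last]
      omega
    rwa [h_last]

/-- The bracket of the bicrossed product of a matched pair of Lie algebras, on `g × h`. -/
def bicrossedLieBracket (ρ : g →ₗ[K] Module.End K h) (ψ : h →ₗ[K] Module.End K g)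
    (z w : g × h) : g × h :=
  (⁅z.1, w.1⁆ + ψ z.2 w.1 - ψ w.2 z.1, ⁅z.2, w.2⁆ + ρ z.1 w.2 - ρ w.1 z.2)

theorem mixedBracket_lieBrackets_lieActions (ψ : h →ₗ[K] Module.End K g) (z : Fin 2 → g × h) :
    mixedBracket (lieBrackets K g 1) (lieActions ψ 1) 0 z =
      ⁅(z 0).1, (z 1).1⁆ + ψ (z 0).2 (z 1).1 - ψ (z 1).2 (z 0).1 := by
  have h_zero : moveSign (0 : Fin (1 + 1) → ℤ) 0 = -1 := by simp [moveSign]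
  have h_one : moveSign (0 : Fin (1 + 1) → ℤ) 1 = 1 := by simp [moveSign]
  rw [mixedBracket_apply, Fin.sum_univ_two, h_zero, h_one, Units.neg_smul, one_smul, one_smul,
    neg_add_eq_sub, ← add_sub_assoc]
  rfl

theorem bicrossedBracket_lieBrackets_lieActions (ρ : g →ₗ[K] Module.End K h)
    (ψ : h →ₗ[K] Module.End K g) (z : Fin 2 → g × h) :
    bicrossedBracket (lieBrackets K g) (lieBrackets K h) (lieActions ρ) (lieActions ψ) 1 0 z =
      bicrossedLieBracket ρ ψ (z 0) (z 1) :=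
  Prod.ext (mixedBracket_lieBrackets_lieActions ψ z)
    (mixedBracket_lieBrackets_lieActions ρ fun i => (z i).swap)

theorem bicrossedBracket_lieBrackets_lieActions_of_ne (ρ : g →ₗ[K] Module.End K h)
    (ψ : h →ₗ[K] Module.End K g) {n : ℕ} (hn : n ≠ 1) (d : Fin (n + 1) → ℤ) :
    bicrossedBracket (lieBrackets K g) (lieBrackets K h) (lieActions ρ) (lieActions ψ) n d = 0 := by
  ext z : 1
  simp [bicrossedBracket_apply, mixedBracket_apply, lieBrackets_of_ne hn, lieActions_of_ne _ hn]

theorem compatTerm_lieBrackets_lieActions (ρ : g →ₗ[K] Module.End K h)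
    (ψ : h →ₗ[K] Module.End K g) (z : Fin (2 + 1) → g × h) :
    compatTerm (lieBrackets K g) (lieBrackets K h) (lieActions ρ) (lieActions ψ) 1 1 0
        (fun i => (z i).1) (fun i => (z i).2) =
      (bicrossedLieBracket ρ ψ (bicrossedLieBracket ρ ψ (z 0) (z 1)) (z 2)).1 -
        (bicrossedLieBracket ρ ψ (bicrossedLieBracket ρ ψ (z 0) (z 2)) (z 1)).1 +
        (bicrossedLieBracket ρ ψ (bicrossedLieBracket ρ ψ (z 1) (z 2)) (z 0)).1 := by
  have h_degrees : (Fin.cons ((∑ i : Fin 2, (0 : Fin 2 → ℤ) i) + (((1 : ℕ) : ℤ) + 1 - 2)) 0 :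
      Fin (1 + 1) → ℤ) = 0 := by decide
  have h_mixed (σ : Equiv.Perm (Fin (2 + 1))) :
      mixedBracket (lieBrackets K g 1) (lieActions ψ 1)
        (Fin.cons ((∑ i : Fin 2, (0 : Fin 2 → ℤ) i) + (((1 : ℕ) : ℤ) + 1 - 2)) 0)
        (Fin.cons (bicrossedBracket (lieBrackets K g) (lieBrackets K h) (lieActions ρ)
          (lieActions ψ) 1 0 fun i => z (σ (Fin.castAdd 1 i))) fun j => z (σ (Fin.natAdd 2 j))) =
      (bicrossedLieBracket ρ ψ (bicrossedLieBracket ρ ψ (z (σ 0)) (z (σ 1))) (z (σ 2))).1 := by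
    rw [h_degrees, mixedBracket_lieBrackets_lieActions, bicrossedBracket_lieBrackets_lieActions]
    rfl
  rw [compatTerm_eq_sum_mixedBracket]
  exact (sum_congr rfl fun σ _ => congrArg _ (h_mixed σ)).trans (sum_shuffles_two_one_degreeZero _)

theorem IsLieMatchedPair.symm {ρ : g →ₗ[K] Module.End K h} {ψ : h →ₗ[K] Module.End K g}
    (hP : IsLieMatchedPair ρ ψ) : IsLieMatchedPair ψ ρ :=
  ⟨hP.rep_right, hP.rep_left, hP.compat_right, hP.compat_left⟩

theorem IsLieMatchedPair.jacobi_fst {ρ : g →ₗ[K] Module.End K h} {ψ : h →ₗ[K] Module.End K g}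
    (hP : IsLieMatchedPair ρ ψ) (z₀ z₁ z₂ : g × h) :
    (bicrossedLieBracket ρ ψ (bicrossedLieBracket ρ ψ z₀ z₁) z₂).1 -
      (bicrossedLieBracket ρ ψ (bicrossedLieBracket ρ ψ z₀ z₂) z₁).1 +
      (bicrossedLieBracket ρ ψ (bicrossedLieBracket ρ ψ z₁ z₂) z₀).1 = 0 := by
  have h_jacobi := lie_lie_sub_lie_lie_add_lie_lie z₀.1 z₁.1 z₂.1
  simp only [bicrossedLieBracket, add_lie, sub_lie, map_add, map_sub, LinearMap.add_apply,
    LinearMap.sub_apply, hP.rep_right, hP.compat_right]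
  rw [← lie_skew z₀.1 (ψ z₁.2 z₂.1), ← lie_skew z₀.1 (ψ z₂.2 z₁.1),
    ← lie_skew z₁.1 (ψ z₀.2 z₂.1), ← h_jacobi]
  abel

theorem sumGrading_degreeZero : sumGrading (degreeZero K g) (degreeZero K h) =
    degreeZero K (g × h) := by
  ext i z
  simp [sumGrading, mem_degreeZero, Prod.ext_iff, or_and_left]

theorem IsLieMatchedPair.compatTerm_eq_zero {ρ : g →ₗ[K] Module.End K h}
    {ψ : h →ₗ[K] Module.End K g} (hP : IsLieMatchedPair ρ ψ) (a b : ℕ)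
    {d : Fin (b + 1 + a) → ℤ} {z : Fin (b + 1 + a) → g × h}
    (hz : ∀ i, z i ∈ degreeZero K (g × h) (d i)) :
    compatTerm (lieBrackets K g) (lieBrackets K h) (lieActions ρ) (lieActions ψ) a b d
      (fun i => (z i).1) (fun i => (z i).2) = 0 := by
  rcases eq_zero_or_exists_eq_zero hz with rfl | ⟨i, -, hi⟩
  · by_cases hab : a = 1 ∧ b = 1
    · obtain ⟨rfl, rfl⟩ := hab
      exact (compatTerm_lieBrackets_lieActions ρ ψ z).trans (hP.jacobi_fst _ _ _)
    · rw [compatTerm_eq_sum_mixedBracket]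
      refine sum_eq_zero fun σ _ => ?_
      rcases not_and_or.1 hab with ha | hb
      · simp [mixedBracket_apply, lieBrackets_of_ne ha, lieActions_of_ne _ ha]
      · rw [bicrossedBracket_lieBrackets_lieActions_of_ne _ _ hb,
          MultilinearMap.map_coord_zero _ 0 rfl, smul_zero]
  · exact LInf.compatTerm_eq_zero _ _ _ _ d hi

theorem IsLieMatchedPair.isMatchedPair {ρ : g →ₗ[K] Module.End K h}
    {ψ : h →ₗ[K] Module.End K g} (hP : IsLieMatchedPair ρ ψ) :
    IsMatchedPair (degreeZero K g) (lieBrackets K g) (degreeZero K h) (lieBrackets K h)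
      (lieActions ρ) (lieActions ψ) where
  left := isLInfinityAlgebra_lieBrackets
  right := isLInfinityAlgebra_lieBrackets
  rep_left := isRepresentation_lieActions hP.rep_left
  rep_right := isRepresentation_lieActions hP.rep_right
  compat_left _ _ x u hx hu := sum_eq_zero fun p _ =>
    hP.compatTerm_eq_zero _ _ (z := fun i => (x (Fin.cast (arity p) i), u (Fin.cast (arity p) i)))
      fun _ => by rw [← sumGrading_degreeZero]; exact ⟨hx _, hu _⟩
  compat_right _ _ x u hx hu := sum_eq_zero fun p _ =>
    hP.symm.compatTerm_eq_zero _ _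
      (z := fun i => (u (Fin.cast (arity p) i), x (Fin.cast (arity p) i)))
      fun _ => by rw [← sumGrading_degreeZero]; exact ⟨hu _, hx _⟩

variable {ρ : g →ₗ[K] Module.End K h} {ψ : h →ₗ[K] Module.End K g} {l : Brackets K (g × h)}

theorem IsBicrossed.lie_apply (hl : IsBicrossed (degreeZero K g) (lieBrackets K g)
      (degreeZero K h) (lieBrackets K h) (lieActions ρ) (lieActions ψ) l) (z w : g × h) :
    l 1 ![z, w] = bicrossedLieBracket ρ ψ z w :=
  (hl.eq_bicrossedBracket fun _ => by simp [sumGrading_degreeZero, mem_degreeZero]).trans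
    (bicrossedBracket_lieBrackets_lieActions ρ ψ ![z, w])

theorem IsBicrossed.lie_of_ne (hl : IsBicrossed (degreeZero K g) (lieBrackets K g)
      (degreeZero K h) (lieBrackets K h) (lieActions ρ) (lieActions ψ) l) {n : ℕ} (hn : n ≠ 1) :
    l n = 0 := by
  ext z : 1
  rw [hl.eq_bicrossedBracket (d := 0) fun _ => by simp [sumGrading_degreeZero, mem_degreeZero],
    bicrossedBracket_lieBrackets_lieActions_of_ne ρ ψ hn]

end Lie

end LInf

theorem mainTheorem9_general {K : Type*} [Field K] :
    (∀ {V W : Type*} [AddCommGroup V] [Module K V] [AddCommGroup W] [Module K W]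
      (𝒢 : ℤ → Submodule K V) (μ : LInf.Brackets K V)
      (ℋ : ℤ → Submodule K W) (ν : LInf.Brackets K W)
      (ρ : LInf.Actions K V W) (ψ : LInf.Actions K W V),
      LInf.IsMatchedPair 𝒢 μ ℋ ν ρ ψ →
      ∃ l : LInf.Brackets K (V × W),
        LInf.IsBicrossed 𝒢 μ ℋ ν ρ ψ l ∧
        LInf.IsLInfinityAlgebra (LInf.sumGrading 𝒢 ℋ) l ∧
        ∀ l' : LInf.Brackets K (V × W), LInf.IsBicrossed 𝒢 μ ℋ ν ρ ψ l' → l' = l) ∧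
    (∀ {g h : Type*} [LieRing g] [LieAlgebra K g] [LieRing h] [LieAlgebra K h]
      (ρ : g →ₗ[K] Module.End K h) (ψ : h →ₗ[K] Module.End K g),
      LInf.IsLieMatchedPair ρ ψ →
      LInf.IsMatchedPair (LInf.degreeZero K g) (LInf.lieBrackets K g)
        (LInf.degreeZero K h) (LInf.lieBrackets K h) (LInf.lieActions ρ) (LInf.lieActions ψ) ∧
      ∀ l : LInf.Brackets K (g × h),
        LInf.IsBicrossed (LInf.degreeZero K g) (LInf.lieBrackets K g)
          (LInf.degreeZero K h) (LInf.lieBrackets K h) (LInf.lieActions ρ) (LInf.lieActions ψ) l →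
        (∀ (x y : g) (u v : h),
          l 1 ![(x, u), (y, v)] = (⁅x, y⁆ + ψ u y - ψ v x, ⁅u, v⁆ + ρ x v - ρ y u)) ∧
        ∀ n : ℕ, n ≠ 1 → l n = 0) := by
  refine ⟨fun 𝒢 μ ℋ ν ρ ψ hP => ?_, fun ρ ψ hP => ⟨hP.isMatchedPair, fun l hl =>
    ⟨fun x y u v => hl.lie_apply (x, u) (y, v), fun _ => hl.lie_of_ne⟩⟩⟩
  obtain ⟨l, hl, hl_unique⟩ :=
    LInf.existsUnique_isBicrossed μ ν ρ ψ hP.left.isInternal hP.right.isInternal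
  exact ⟨l, hl, hl.isLInfinityAlgebra hP, hl_unique⟩

theorem mainTheorem9 {K : Type*} [Field K] [CharZero K] :
    (∀ {V W : Type*} [AddCommGroup V] [Module K V] [AddCommGroup W] [Module K W]
      (𝒢 : ℤ → Submodule K V) (μ : LInf.Brackets K V)
      (ℋ : ℤ → Submodule K W) (ν : LInf.Brackets K W)
      (ρ : LInf.Actions K V W) (ψ : LInf.Actions K W V),
      LInf.IsMatchedPair 𝒢 μ ℋ ν ρ ψ →
      ∃ l : LInf.Brackets K (V × W),
        LInf.IsBicrossed 𝒢 μ ℋ ν ρ ψ l ∧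
        LInf.IsLInfinityAlgebra (LInf.sumGrading 𝒢 ℋ) l ∧
        ∀ l' : LInf.Brackets K (V × W), LInf.IsBicrossed 𝒢 μ ℋ ν ρ ψ l' → l' = l) ∧
    (∀ {g h : Type*} [LieRing g] [LieAlgebra K g] [LieRing h] [LieAlgebra K h]
      (ρ : g →ₗ[K] Module.End K h) (ψ : h →ₗ[K] Module.End K g),
      LInf.IsLieMatchedPair ρ ψ →
      LInf.IsMatchedPair (LInf.degreeZero K g) (LInf.lieBrackets K g)
        (LInf.degreeZero K h) (LInf.lieBrackets K h) (LInf.lieActions ρ) (LInf.lieActions ψ) ∧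
      ∀ l : LInf.Brackets K (g × h),
        LInf.IsBicrossed (LInf.degreeZero K g) (LInf.lieBrackets K g)
          (LInf.degreeZero K h) (LInf.lieBrackets K h) (LInf.lieActions ρ) (LInf.lieActions ψ) l →
        (∀ (x y : g) (u v : h),
          l 1 ![(x, u), (y, v)] = (⁅x, y⁆ + ψ u y - ψ v x, ⁅u, v⁆ + ρ x v - ρ y u)) ∧
        ∀ n : ℕ, n ≠ 1 → l n = 0) :=
  mainTheorem9_general
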